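/- **Setting.** Let $(\Omega,\mathcal F,P)$ be a probability space and $\sigma$ the surface measure on the unit sphere $\mathbb S^2\subset\mathbb R^3$, $\sigma(\mathbb S^2)=4\pi$. Let $Y_{l,m}$ ($l\in\mathbb N_0$, $-l\le m\le l$) be the standard complex orthonormal spherical harmonics of degree $l$ and order $m$. Let $\Gamma\subsetneq\mathbb S^2$ be a measurable set with nonempty interior, and let $\mathcal A(T)=T$ on $\Gamma$, $\mathcal A(T)=0$ on $\mathbb S^2\setminus\Gamma$. Fix $0<p<1$, $\eta>1$, and the weights $\beta_0=1$, $\beta_l=\eta^l l^p$ for $l\ge1$. For $\alpha=(\alpha_{l\cdot})_{l\ge 0}$ with $\alpha_{l\cdot}=(\alpha_{l,-l},\dots,\alpha_{l,l})^T\in\mathbb C^{2l+1}$ let $\|\alpha_{l\cdot}\|$ be the Euclidean norm, and let $$\ell^p_\beta=\Big\{\alpha:\ \sum_l\|\alpha_{l\cdot}\|^2<\infty,\ \sum_l\beta_l\|\alpha_{l\cdot}\|^p<\infty\Big\}.$$ Let $Y$ be the infinite matrix with entries $\int_\Gamma\overline{Y_{l,m}}\,Y_{l',m'}\,d\sigma$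 (row $(l,m)$, column $(l',m')$). For $T^\circ\in L_2(\mathbb S^2)$ real-valued and $\varrho\in\mathbb R$ put $\alpha^\circ_{l,m}=\int_\Gamma T^\circ\,\overline{Y_{l,m}}\,d\sigma$, $c=\int_{\mathbb S^2}|T^\circ|^2d\sigma$ and $g(\alpha)=\alpha^HY\alpha-2\,\mathrm{Re}(\alpha^H\alpha^\circ)+c$. A *scaled KKT point* of the problem $\min\{\sum_l\beta_l\|\alpha_{l\cdot}\|^p:\alpha\in\ell^p_\beta,\ g(\alpha)\le\varrho\}$ is an $\alpha^*\in\ell^p_\beta$ for which there is a $\nu\ge0$ with $$p\beta_l\|\alpha^*_{l\cdot}\|^p\alpha^*_{l\cdot}+2\nu\|\alpha^*_{l\cdot}\|^2\big((Y\alpha^*)_{l\cdot}-\alpha^\circ_{l\cdot}\big)=0\quad(l\in\mathbb N_0),\qquad \nu\,(g(\alpha^*)-\varrho)=0,\qquad g(\alpha^*)\le\varrho .$$ **Theorem 5.2.** Let $T^\circ\in L_2(\Omega\times\mathbb S^2)=L_2(P\otimes\sigma)$ be real-valued (the observed random field), and let $\varrho$ be a constant with $$\int_{\mathbb S^2\setminus\Gamma}|T^\circ(\omega,\mathrm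 x)|^2d\sigma(\mathrm x)<\varrho<\int_{\mathbb S^2}|T^\circ(\omega,\mathrm x)|^2d\sigma(\mathrm x)\qquad\text{for } P\text{-a.e. }\omega .$$ Let $\alpha^*_{l,m}:\Omega\to\mathbb C$ be random variables such that, for $P$-a.e. $\omega$, $\alpha^*(\omega)$ is a scaled KKT point of the above problem for $T^\circ(\omega,\cdot)$, and let $$T^*(\omega,\mathrm x)=\sum_{l=0}^\infty\sum_{m=-l}^l\alpha^*_{l,m}(\omega)Y_{l,m}(\mathrm x),\qquad T^*_L(\omega,\mathrm x)=\sum_{l=0}^L\sum_{m=-l}^l\alpha^*_{l,m}(\omega)Y_{l,m}(\mathrm x).$$ Suppose that there are a map $\xi$ from $\Omega$ to a normed space with $\mathbb E\|\xi\|^2<\infty$ and a constant $\kappa\ge 0$ such that $\|T^*(\omega_1,\cdot)-T^*(\omega_2,\cdot)\|_{L_2(\mathbb S^2)}\le\kappa\|\xi(\omega_1)-\xi(\omega_2)\|$ for $P$-a.e. $\omega_1$ and $P$-a.e. $\omega_2$ (for instance $\Omega$ is a subset of a normed space and $\xi(\omega)=\omega$; the condition also holds whenever $T^*\in L_2(\Omega\times\mathbb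 S^2)$). Then for every $\epsilon>0$ there is an $L\in\mathbb N_0$ such that $\mathcal A(T^*_L)-T^\circ\in L_2(\Omega\times\mathbb S^2)$ and $$0\le\|\mathcal A(T^*_L)-T^\circ\|^2_{L_2(\Omega\times\mathbb S^2)}-\varrho<\epsilon .$$ -/

import Mathlib

open MeasureTheory
open scoped ENNReal NNReal ComplexConjugate

noncomputable section

namespace SphereInpainting

/-- The unit sphere of `ℝ³`. -/
abbrev S2 : Type := Metric.sphere (0 : EuclideanSpace ℝ (Fin 3)) 1

/-- The surface measure of the unit sphere, of total mass `4π`. -/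
def sigma : Measure S2 := (volume : Measure (EuclideanSpace ℝ (Fin 3))).toSphere

/-- The Legendre polynomial of degree `l`, by Rodrigues' formula. -/
def legendre (l : ℕ) : Polynomial ℝ :=
  Polynomial.C (1 / (2 ^ l * (l.factorial : ℝ))) *
    Polynomial.derivative^[l] ((Polynomial.X ^ 2 - 1) ^ l)

/-- The spherical harmonic of degree `l` and order `m` with `0 ≤ m ≤ l`. With
`x = (sin θ cos φ, sin θ sin φ, cos θ)` one has `sin θ ^ m * exp (i m φ) = (x₀ + i x₁) ^ m`, so that
this is `√((2l+1)/(4π) · (l-m)!/(l+m)!) · P_l^m(cos θ) · exp (i m φ)`, where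
`P_l^m(t) = (-1)^m (1 - t²)^(m/2) P_l⁽ᵐ⁾(t)` is the associated Legendre function. -/
def sphHarmNat (l m : ℕ) (x : S2) : ℂ :=
  (-1) ^ m *
    (Real.sqrt ((2 * l + 1) / (4 * Real.pi) *
      (((l - m).factorial : ℝ) / ((l + m).factorial : ℝ))) : ℂ) *
    (((x.1 0 : ℝ) : ℂ) + Complex.I * ((x.1 1 : ℝ) : ℂ)) ^ m *
    (((Polynomial.derivative^[m] (legendre l)).eval (x.1 2) : ℝ) : ℂ)

/-- The (complex, orthonormal) spherical harmonic `Y_{l,m}` of degree `l` and order `m`,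
`-l ≤ m ≤ l`, with `Y_{l,-m} = (-1)^m conj Y_{l,m}`. -/
def sphHarm (l : ℕ) (m : ℤ) (x : S2) : ℂ :=
  if 0 ≤ m then sphHarmNat l m.natAbs x
  else (-1) ^ m.natAbs * conj (sphHarmNat l m.natAbs x)

/-- The orders `m = -l, …, l` that belong to degree `l`. -/
abbrev Orders (l : ℕ) : Type := Finset.Icc (-(l : ℤ)) (l : ℤ)

/-- Coefficient vectors in their group structure: the group `α l` is a vector of `ℂ^(2l+1)`
with the `ℓ²` norm. -/
abbrev Coeff : Type := (l : ℕ) → EuclideanSpace ℂ (Orders l)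

/-- The degree-`l` part `∑_{m=-l}^{l} α_{l,m} Y_{l,m}` of a field. -/
def degreePart (α : Coeff) (l : ℕ) (x : S2) : ℂ :=
  ∑ m : Orders l, α l m * sphHarm l m x

/-- The field `∑_{l=0}^∞ ∑_{m=-l}^{l} α_{l,m} Y_{l,m}`. -/
def field (α : Coeff) (x : S2) : ℂ := ∑' l : ℕ, degreePart α l x

/-- The truncated field `∑_{l=0}^L ∑_{m=-l}^{l} α_{l,m} Y_{l,m}`. -/
def truncField (L : ℕ) (α : Coeff) (x : S2) : ℂ :=
  ∑ l ∈ Finset.range (L + 1), degreePart α l x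

/-- The inpainting operator: it keeps a field on `Γ` and replaces it by `0` off `Γ`. -/
def inpaint (Γ : Set S2) (T : S2 → ℂ) : S2 → ℂ := Γ.indicator T

/-- The weights `β_0 = 1`, `β_l = η^l l^p` for `l ≥ 1`. -/
def weight (η p : ℝ) (l : ℕ) : ℝ := if l = 0 then 1 else η ^ l * (l : ℝ) ^ p

/-- The weighted space `ℓ^p_β`. -/
def MemEll (η p : ℝ) (α : Coeff) : Prop :=
  (Summable fun l => ‖α l‖ ^ 2) ∧ Summable fun l => weight η p l * ‖α l‖ ^ p

/-- The entry `∫_Γ conj Y_{l,m} · Y_{l',m'} dσ` of the infinite matrix `Y`, for which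
`αᴴ Y α = ∫_Γ |∑ α_{l,m} Y_{l,m}|² dσ`. -/
def gram (Γ : Set S2) (l : ℕ) (m : ℤ) (l' : ℕ) (m' : ℤ) : ℂ :=
  ∫ x in Γ, conj (sphHarm l m x) * sphHarm l' m' x ∂sigma

/-- The group `(Y α)_{l·}`. -/
def gramMul (Γ : Set S2) (α : Coeff) : Coeff := fun l =>
  WithLp.toLp 2 fun m : Orders l =>
    ∑' l' : ℕ, ∑ m' : Orders l', gram Γ l m l' m' * α l' m'

/-- The vector `α°` with entries `∫_Γ T° · conj Y_{l,m} dσ`. -/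
def obsCoeff (Γ : Set S2) (To : S2 → ℝ) : Coeff := fun l =>
  WithLp.toLp 2 fun m : Orders l => ∫ x in Γ, (To x : ℂ) * conj (sphHarm l m x) ∂sigma

/-- The product `αᴴ b = ∑_l ∑_m conj α_{l,m} · b_{l,m}`. -/
def hdot (α b : Coeff) : ℂ := ∑' l : ℕ, ∑ m : Orders l, conj (α l m) * b l m

/-- The constraint function `αᴴ Y α - 2 Re (αᴴ α°) + c` with `c = ∫ |T°|² dσ`. -/
def constraintFn (Γ : Set S2) (To : S2 → ℝ) (α : Coeff) : ℝ :=
  (hdot α (gramMul Γ α)).re - 2 * (hdot α (obsCoeff Γ To)).re + ∫ x, To x ^ 2 ∂sigma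

/-- `α` is a scaled KKT point of the problem of minimizing `∑_l β_l ‖α_{l·}‖^p` over `ℓ^p_β`
subject to `αᴴ Y α - 2 Re (αᴴ α°) + c ≤ ϱ`. -/
def IsScaledKKT (η p rho : ℝ) (Γ : Set S2) (To : S2 → ℝ) (α : Coeff) : Prop :=
  MemEll η p α ∧ ∃ ν : ℝ,
    (∀ l : ℕ, (p * weight η p l * ‖α l‖ ^ p) • α l +
      (2 * ν * ‖α l‖ ^ 2) • (gramMul Γ α l - obsCoeff Γ To l) = 0) ∧
    ν * (constraintFn Γ To α - rho) = 0 ∧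
    constraintFn Γ To α ≤ rho ∧
    0 ≤ ν

end SphereInpainting

end

/-!
Stationarity turns each group `T_l` of a scaled KKT point against the residual `𝒜(T) - T°`:
`Re ⟪𝒜(T_l), 𝒜(T) - T°⟫ ≤ 0`. Cutting off the tail `R = ∑_{l > L} T_l` therefore cannot decrease the
misfit,
`‖𝒜(T_L) - T°‖² = ‖𝒜(T) - T°‖² - 2 Re ⟪𝒜(R), 𝒜(T) - T°⟫ + ‖𝒜(R)‖² ≥ ‖𝒜(T) - T°‖²`,
and the right-hand side equals `ϱ`, as the constraint is active: otherwise the multiplier vanishes,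
hence `α = 0`, which is infeasible. As `L → ∞` the misfits tend to `ϱ` for almost every outcome, and
by Bessel's inequality and the Lipschitz condition (comparing with one fixed outcome) they are
dominated by a square integrable random variable, so their second moments tend to `ϱ` as well.

The spherical harmonics are orthonormal because rotations about the third axis separate the orders
and, for a fixed order, Archimedes' hat-box theorem reduces the integrals to those of the associated
Legendre functions, which follow from integration by parts.
-/

namespace SphereInpainting

section Legendre

open Polynomial

theorem iterate_derivative_X_sq_sub_one_pow {R : Type*} [CommRing R] (l k : ℕ) :
    (X ^ 2 - 1) * derivative^[k + 2] ((X ^ 2 - 1 : R[X]) ^ l) +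
      C (2 * ((k : R) + 1) - 2 * l) * X * derivative^[k + 1] ((X ^ 2 - 1 : R[X]) ^ l) +
      C (((k : R) + 1) * (k - 2 * l)) * derivative^[k] ((X ^ 2 - 1 : R[X]) ^ l) = 0 := by
  have base : (X ^ 2 - 1) * derivative ((X ^ 2 - 1 : R[X]) ^ l) =
      C (2 * (l : R)) * X * (X ^ 2 - 1 : R[X]) ^ l := by
    rcases l with _ | l
    · simp
    · rw [derivative_pow]
      simp only [derivative_sub, derivative_X_pow, derivative_one, map_mul, map_natCast,
        Nat.add_sub_cancel]
      push_cast
      simp only [map_ofNat]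
      ring
  induction k with
  | zero =>
    have h := congrArg derivative base
    simp only [derivative_mul, derivative_sub, derivative_X_pow, derivative_one, derivative_C,
      derivative_X] at h
    simp only [Function.iterate_succ, Function.iterate_zero, Function.comp_apply, id_eq,
      Nat.cast_zero, zero_add, map_sub, map_mul, map_ofNat, map_natCast, zero_sub,
      map_neg, Nat.cast_ofNat, mul_one, one_mul] at h ⊢
    linear_combination h
  | succ k ih =>
    have h := congrArg derivative ih
    simp only [derivative_add, derivative_mul, derivative_sub, derivative_X_pow, derivative_one,
      derivative_C, derivative_X, ← Function.iterate_succ_apply' derivative, derivative_zero] at h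
    simp only [map_sub, map_mul, map_one, map_ofNat, map_natCast, map_add, Nat.cast_ofNat,
      Nat.succ_eq_add_one] at h
    simp only [map_sub, map_mul, map_one, map_ofNat, map_natCast, map_add, Nat.cast_add,
      Nat.cast_one, add_right_comm k 1]
    rw [show k + 1 + 2 = k + 2 + 1 by ring, show k + 1 + 1 = k + 2 by ring] at h ⊢
    linear_combination h

theorem sq_sub_one_mul_iterate_derivative_legendre (l m : ℕ) :
    (X ^ 2 - 1) * derivative^[m + 2] (legendre l) +
      C (2 * ((m : ℝ) + 1)) * X * derivative^[m + 1] (legendre l) =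
      C (((l : ℝ) - m) * (l + m + 1)) * derivative^[m] (legendre l) := by
  have h := iterate_derivative_X_sq_sub_one_pow (R := ℝ) l (m + l)
  simp only [legendre, iterate_derivative_C_mul, ← Function.iterate_add_apply]
  rw [show m + l + 2 = m + 2 + l by ring, show m + l + 1 = m + 1 + l by ring] at h
  simp only [map_sub, map_mul, map_one, map_ofNat, map_natCast, map_add, Nat.cast_add] at h ⊢
  linear_combination (C (1 / (2 ^ l * (l.factorial : ℝ)))) * h

theorem derivative_one_sub_sq_pow_mul_iterate_derivative_legendre (l m : ℕ) :
    derivative ((1 - X ^ 2) ^ (m + 1) * derivative^[m + 1] (legendre l)) =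
      -C (((l : ℝ) - m) * (l + m + 1)) * ((1 - X ^ 2) ^ m * derivative^[m] (legendre l)) := by
  have h := sq_sub_one_mul_iterate_derivative_legendre l m
  rw [derivative_mul, derivative_pow, ← Function.iterate_succ_apply' derivative]
  simp only [derivative_X_pow, derivative_one,
    map_mul, map_natCast, Nat.add_sub_cancel, map_add, map_sub, map_ofNat, map_one,
    Nat.succ_eq_add_one, Nat.cast_add, Nat.cast_one, Nat.cast_ofNat] at h ⊢
  rw [show m + 1 + 1 = m + 2 by ring]
  linear_combination (-(1 - X ^ 2) ^ m) * h

theorem integral_eval_derivative (q : ℝ[X]) (a b : ℝ) :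
    ∫ t in a..b, (derivative q).eval t = q.eval b - q.eval a :=
  intervalIntegral.integral_eq_sub_of_hasDerivAt (fun t _ => q.hasDerivAt t)
    (derivative q).continuous.continuousOn.intervalIntegrable

/-- The inner product on `[-1, 1]` of the `m`-th derivatives of two Legendre polynomials for the
weight `(1 - t²)^m`, that is, of the associated Legendre functions of order `m`. -/
noncomputable def legendreInner (m l l' : ℕ) : ℝ :=
  ∫ t in (-1 : ℝ)..1,
    ((1 - X ^ 2) ^ m * (derivative^[m] (legendre l) * derivative^[m] (legendre l'))).eval t

theorem legendreInner_comm (m l l' : ℕ) : legendreInner m l l' = legendreInner m l' l := by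
  simp only [legendreInner, mul_comm]

-- Integrate by parts: the boundary terms vanish with the weight `(1 - t²)^(m + 1)`.
theorem legendreInner_succ (m l l' : ℕ) :
    legendreInner (m + 1) l l' = ((l : ℝ) - m) * (l + m + 1) * legendreInner m l l' := by
  have h := integral_eval_derivative
    ((1 - X ^ 2) ^ (m + 1) * derivative^[m + 1] (legendre l) * derivative^[m] (legendre l')) (-1) 1
  have hderiv : ∀ t : ℝ, (derivative ((1 - X ^ 2) ^ (m + 1) * derivative^[m + 1] (legendre l) *
        derivative^[m] (legendre l'))).eval t =
      ((1 - X ^ 2) ^ (m + 1) *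
        (derivative^[m + 1] (legendre l) * derivative^[m + 1] (legendre l'))).eval t -
      ((l : ℝ) - m) * (l + m + 1) * ((1 - X ^ 2) ^ m *
        (derivative^[m] (legendre l) * derivative^[m] (legendre l'))).eval t := by
    intro t
    rw [derivative_mul, derivative_one_sub_sq_pow_mul_iterate_derivative_legendre,
      ← Function.iterate_succ_apply' derivative]
    simp only [eval_add, eval_mul, eval_neg, eval_C, Nat.succ_eq_add_one]
    ring
  simp only [hderiv] at h
  rw [intervalIntegral.integral_sub ((Polynomial.continuous _).intervalIntegrable _ _)
      (((Polynomial.continuous _).const_mul _).intervalIntegrable _ _),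
    intervalIntegral.integral_const_mul] at h
  rw [← sub_eq_zero, legendreInner, legendreInner, h]
  simp

theorem legendreInner_of_ne {l l' : ℕ} (h : l ≠ l') (m : ℕ) : legendreInner m l l' = 0 := by
  induction m with
  | zero =>
    have hsymm := legendreInner_comm 1 l l'
    rw [legendreInner_succ, legendreInner_succ, legendreInner_comm 0 l' l] at hsymm
    have hprod : ((l : ℝ) - l') * (l + l' + 1) * legendreInner 0 l l' = 0 := by
      push_cast at hsymm
      linear_combination hsymm
    have hsub : (l : ℝ) - l' ≠ 0 := sub_ne_zero.2 (Nat.cast_injective.ne h)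
    have hadd : (l : ℝ) + l' + 1 ≠ 0 := by positivity
    exact (mul_eq_zero.1 hprod).resolve_left (mul_ne_zero hsub hadd)
  | succ m ih => rw [legendreInner_succ, ih, mul_zero]

theorem legendreInner_self_mul_factorial {l m : ℕ} (hm : m ≤ l) :
    legendreInner m l l * (l - m).factorial = (l + m).factorial * legendreInner 0 l l := by
  induction m with
  | zero => simp [mul_comm]
  | succ m ih =>
    have ih := ih (by omega)
    rw [show l - m = (l - (m + 1)) + 1 by omega, Nat.factorial_succ] at ih
    rw [legendreInner_succ, ← add_assoc, Nat.factorial_succ]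
    push_cast [Nat.cast_sub hm] at ih ⊢
    linear_combination ((l : ℝ) + m + 1) * ih

theorem integral_one_sub_sq_pow_succ (l : ℕ) :
    (2 * l + 3 : ℝ) * ∫ t in (-1 : ℝ)..1, (1 - t ^ 2) ^ (l + 1) =
      (2 * (l + 1) : ℝ) * ∫ t in (-1 : ℝ)..1, (1 - t ^ 2) ^ l := by
  have h := integral_eval_derivative (X * (1 - X ^ 2 : ℝ[X]) ^ (l + 1)) (-1) 1
  have hderiv : ∀ t : ℝ, (derivative (X * (1 - X ^ 2 : ℝ[X]) ^ (l + 1))).eval t =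
      (2 * l + 3) * (1 - t ^ 2) ^ (l + 1) - 2 * (l + 1) * (1 - t ^ 2) ^ l := by
    intro t
    rw [derivative_mul, derivative_pow]
    simp only [derivative_X, one_mul, Nat.cast_add, Nat.cast_one, map_add, map_natCast, map_one,
      add_tsub_cancel_right, derivative_sub, derivative_one, derivative_X_pow_succ, pow_one,
      zero_sub, mul_neg, eval_add, eval_pow, eval_sub, eval_one, eval_X, eval_neg, eval_mul,
      eval_natCast]
    ring
  simp only [hderiv] at h
  rw [intervalIntegral.integral_sub (Continuous.intervalIntegrable (by fun_prop) _ _)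
      (Continuous.intervalIntegrable (by fun_prop) _ _),
    intervalIntegral.integral_const_mul, intervalIntegral.integral_const_mul] at h
  rw [← sub_eq_zero, h]
  simp

theorem integral_one_sub_sq_pow (l : ℕ) :
    (∫ t in (-1 : ℝ)..1, (1 - t ^ 2) ^ l) * (2 * l + 1).factorial =
      2 * 4 ^ l * (l.factorial : ℝ) ^ 2 := by
  induction l with
  | zero => norm_num
  | succ l ih =>
    have h := integral_one_sub_sq_pow_succ l
    rw [show 2 * (l + 1) + 1 = 2 * l + 1 + 1 + 1 by ring, Nat.factorial_succ (2 * l + 1 + 1),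
      Nat.factorial_succ (2 * l + 1), Nat.factorial_succ l]
    push_cast
    linear_combination ((2 * l + 1).factorial * (2 * l + 2) : ℝ) * h + 4 * (l + 1) ^ 2 * ih

theorem iterate_derivative_natDegree {R : Type*} [Semiring R] (q : R[X]) :
    derivative^[q.natDegree] q = C (q.natDegree.factorial * q.leadingCoeff) := by
  rw [eq_C_of_natDegree_le_zero ((natDegree_iterate_derivative _ _).trans (by simp)),
    coeff_iterate_derivative, zero_add, Nat.descFactorial_self, nsmul_eq_mul, leadingCoeff]

theorem iterate_derivative_legendre_self (l : ℕ) :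
    derivative^[l] (legendre l) = C (((2 * l).factorial : ℝ) / (2 ^ l * l.factorial)) := by
  have hmonic : (X ^ 2 - 1 : ℝ[X]).Monic := by
    simpa using monic_X_pow_sub_C (1 : ℝ) two_ne_zero
  have hdeg : ((X ^ 2 - 1 : ℝ[X]) ^ l).natDegree = 2 * l := by
    rw [hmonic.natDegree_pow, mul_comm]
    congr 1
    simpa using natDegree_X_pow_sub_C (n := 2) (r := (1 : ℝ))
  have h := iterate_derivative_natDegree ((X ^ 2 - 1 : ℝ[X]) ^ l)
  rw [hdeg, (hmonic.pow l).leadingCoeff, mul_one] at h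
  rw [legendre, iterate_derivative_C_mul, ← Function.iterate_add_apply, ← two_mul, h, ← C_mul]
  congr 1
  ring

theorem legendreInner_self_self (l : ℕ) :
    legendreInner l l l = (((2 * l).factorial : ℝ) / (2 ^ l * l.factorial)) ^ 2 *
      ∫ t in (-1 : ℝ)..1, (1 - t ^ 2) ^ l := by
  rw [legendreInner, iterate_derivative_legendre_self, ← intervalIntegral.integral_const_mul]
  refine intervalIntegral.integral_congr fun t _ => ?_
  simp only [eval_mul, eval_C, eval_pow, eval_sub, eval_one, eval_X]
  ring

theorem legendreInner_zero_self (l : ℕ) : legendreInner 0 l l = 2 / (2 * l + 1) := by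
  have h := legendreInner_self_mul_factorial (le_refl l)
  have hB := integral_one_sub_sq_pow l
  rw [legendreInner_self_self, Nat.sub_self, Nat.factorial_zero, ← two_mul] at h
  rw [Nat.factorial_succ, show (4 : ℝ) ^ l = (2 ^ l) ^ 2 by rw [← pow_mul', pow_mul]; norm_num]
    at hB
  have hf : ((2 * l).factorial : ℝ) ≠ 0 := by positivity
  have hf' : (l.factorial : ℝ) ≠ 0 := by positivity
  push_cast at hB h
  generalize (∫ t in (-1 : ℝ)..1, (1 - t ^ 2) ^ l) = B at h hB
  rw [eq_div_iff (by positivity)]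
  field_simp at h
  apply mul_left_cancel₀ (pow_ne_zero 2 (mul_ne_zero (pow_ne_zero l (two_ne_zero (α := ℝ))) hf'))
  linear_combination -(2 * l + 1 : ℝ) * h + hB

theorem legendreInner_self {l m : ℕ} (hm : m ≤ l) :
    legendreInner m l l = 2 / (2 * l + 1) * ((l + m).factorial / (l - m).factorial) := by
  have h := legendreInner_self_mul_factorial hm
  rw [legendreInner_zero_self] at h
  field_simp at h ⊢
  linear_combination h

end Legendre

section SphereIntegration

variable {E : Type*} [NormedAddCommGroup E] [NormedSpace ℝ E]

/-- The action of a linear isometry on the unit sphere. -/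
def sphereMap (e : E ≃ₗᵢ[ℝ] E) (x : Metric.sphere (0 : E) 1) : Metric.sphere (0 : E) 1 :=
  ⟨e x, by simp⟩

theorem continuous_sphereMap (e : E ≃ₗᵢ[ℝ] E) : Continuous (sphereMap e) :=
  (e.continuous.comp continuous_subtype_val).subtype_mk _

variable [MeasurableSpace E] [BorelSpace E]

open scoped Pointwise in
theorem measurePreserving_sphereMap {μ : Measure E} {e : E ≃ₗᵢ[ℝ] E}
    (he : MeasurePreserving e μ μ) :
    MeasurePreserving (sphereMap e) μ.toSphere μ.toSphere := by
  have hm : Measurable (sphereMap e) := (continuous_sphereMap e).measurable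
  refine ⟨hm, Measure.ext fun s hs => ?_⟩
  have hcone : Set.Ioo (0 : ℝ) 1 • (Subtype.val '' (sphereMap e ⁻¹' s)) =
      e ⁻¹' (Set.Ioo (0 : ℝ) 1 • (Subtype.val '' s)) := by
    ext y
    simp only [Set.mem_smul, Set.mem_image, Set.mem_preimage, Subtype.exists, exists_and_right,
      exists_eq_right]
    constructor
    · rintro ⟨r, hr, z, ⟨hz, hzs⟩, rfl⟩
      exact ⟨r, hr, e z, ⟨by simpa using hz, hzs⟩, by simp⟩
    · rintro ⟨r, hr, z, ⟨hz, hzs⟩, h⟩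
      exact ⟨r, hr, e.symm z, ⟨by simpa using hz, by simpa [sphereMap] using hzs⟩,
        e.injective (by simp [← h])⟩
  rw [Measure.map_apply hm hs, Measure.toSphere_apply' _ (hm hs), Measure.toSphere_apply' _ hs,
    hcone, he.measure_preimage_emb e.toHomeomorph.measurableEmbedding]

theorem integral_sphereMap {μ : Measure E} {e : E ≃ₗᵢ[ℝ] E} (he : MeasurePreserving e μ μ)
    {F : Type*} [NormedAddCommGroup F] [NormedSpace ℝ F] (f : Metric.sphere (0 : E) 1 → F) :
    ∫ x, f (sphereMap e x) ∂μ.toSphere = ∫ x, f x ∂μ.toSphere := by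
  have hinv : ∀ x, sphereMap e (sphereMap e.symm x) = x ∧ sphereMap e.symm (sphereMap e x) = x :=
    fun x => ⟨Subtype.ext (e.apply_symm_apply x), Subtype.ext (e.symm_apply_apply x)⟩
  exact (measurePreserving_sphereMap he).integral_comp
    (Homeomorph.measurableEmbedding ⟨⟨_, _, fun x => (hinv x).2, fun x => (hinv x).1⟩,
      continuous_sphereMap e, continuous_sphereMap e.symm⟩) f

theorem integral_volumeIoiPow (n : ℕ) (h : ℝ → ℝ) :
    ∫ r, h r ∂(Measure.volumeIoiPow n) = ∫ r in Set.Ioi (0 : ℝ), r ^ n * h r := by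
  simp only [Measure.volumeIoiPow, ENNReal.ofReal]
  rw [integral_withDensity_eq_integral_smul
      (measurable_subtype_coe.pow_const _).real_toNNReal,
    integral_subtype_comap measurableSet_Ioi fun a : ℝ => Real.toNNReal (a ^ n) • h a]
  refine setIntegral_congr_fun measurableSet_Ioi fun r hr => ?_
  simp only [NNReal.smul_def, Real.coe_toNNReal _ (pow_nonneg (Set.mem_Ioi.1 hr).le n), smul_eq_mul]

theorem integral_mul_comp_norm [FiniteDimensional ℝ E] [Nontrivial E] (μ : Measure E)
    [μ.IsAddHaarMeasure] (g : E → ℝ) (h : ℝ → ℝ) :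
    ∫ x, g (‖x‖⁻¹ • x) * h ‖x‖ ∂μ =
      (∫ x : Metric.sphere (0 : E) 1, g x ∂μ.toSphere) *
        ∫ r in Set.Ioi (0 : ℝ), r ^ (Module.finrank ℝ E - 1) * h r :=
  calc
    _ = ∫ x : ({0}ᶜ : Set E), g (‖x.1‖⁻¹ • x.1) * h ‖x.1‖ ∂(μ.comap Subtype.val) := by
      rw [integral_subtype_comap (measurableSet_singleton _).compl
        fun x => g (‖x‖⁻¹ • x) * h ‖x‖, restrict_compl_singleton]
    _ = ∫ z : Metric.sphere (0 : E) 1 × Set.Ioi (0 : ℝ), g z.1 * h z.2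
        ∂(μ.toSphere.prod (.volumeIoiPow (Module.finrank ℝ E - 1))) := by
      simpa using μ.measurePreserving_homeomorphUnitSphereProd.integral_comp
        (Homeomorph.measurableEmbedding _)
        fun z : Metric.sphere (0 : E) 1 × Set.Ioi (0 : ℝ) => g z.1 * h z.2
    _ = _ := by
      rw [integral_prod_mul (fun x : Metric.sphere (0 : E) 1 => g x)
        fun r : Set.Ioi (0 : ℝ) => h r, integral_volumeIoiPow]

end SphereIntegration

section Archimedes

instance : IsFiniteMeasure sigma :=
  inferInstanceAs (IsFiniteMeasure (volume : Measure (EuclideanSpace ℝ (Fin 3))).toSphere)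

theorem integral_Ioi_pow_mul_exp_neg_sq (n : ℕ) :
    ∫ t in Set.Ioi (0 : ℝ), t ^ n * Real.exp (-t ^ 2) = Real.Gamma ((n + 1) / 2) / 2 := by
  have h := integral_rpow_mul_exp_neg_rpow (p := 2) (q := n) two_pos
    (neg_one_lt_zero.trans_le n.cast_nonneg)
  simp only [Real.rpow_natCast, Real.rpow_two] at h
  rw [h]
  ring

theorem integral_pow_mul_exp_neg_sq {n : ℕ} (hn : Even n) :
    ∫ t : ℝ, t ^ n * Real.exp (-t ^ 2) = Real.Gamma ((n + 1) / 2) := by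
  have h := integral_comp_abs (f := fun s : ℝ => s ^ n * Real.exp (-s ^ 2))
  simp only [hn.pow_abs, sq_abs] at h
  rw [h, integral_Ioi_pow_mul_exp_neg_sq]
  ring

theorem integral_prod_pow_mul_exp_neg_norm_sq {ι : Type*} [Fintype ι] {n : ι → ℕ}
    (hn : ∀ i, Even (n i)) :
    ∫ x : EuclideanSpace ℝ ι, (∏ i, x i ^ n i) * Real.exp (-‖x‖ ^ 2) =
      ∏ i, Real.Gamma ((n i + 1) / 2) := by
  have h := (EuclideanSpace.volume_preserving_symm_measurableEquiv_toLp ι).integral_comp'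
    (g := fun y : ι → ℝ => ∏ i, (y i ^ n i * Real.exp (-y i ^ 2)))
  rw [integral_fintype_prod_volume_eq_prod
    (f := fun (i : ι) (t : ℝ) => t ^ n i * Real.exp (-t ^ 2))] at h
  simp only [integral_pow_mul_exp_neg_sq (hn _)] at h
  rw [← h]
  congr 1
  ext x
  simp [EuclideanSpace.norm_sq_eq, Finset.prod_mul_distrib, ← Real.exp_sum]

theorem integral_height_pow_mul_exp_neg_norm_sq {n : ℕ} (hn : Even n) :
    ∫ x : EuclideanSpace ℝ (Fin 3), x 2 ^ n * Real.exp (-‖x‖ ^ 2) =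
      Real.pi * Real.Gamma ((n + 1) / 2) := by
  have h := integral_prod_pow_mul_exp_neg_norm_sq (n := ![0, 0, n])
    (by simp [Fin.forall_fin_succ, hn])
  have hpi : Real.Gamma (1 / 2) * Real.Gamma (1 / 2) = Real.pi := by
    rw [Real.Gamma_one_half_eq, Real.mul_self_sqrt Real.pi_pos.le]
  simpa [Fin.prod_univ_three, ← hpi] using h

theorem integral_height_pow_of_even {n : ℕ} (hn : Even n) :
    ∫ x : S2, x.1 2 ^ n ∂sigma = 4 * Real.pi / (n + 1) := by
  -- Integrate `x₂ⁿ exp (-‖x‖²)` over `ℝ³` in polar and in Cartesian coordinates.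
  have hpolar := integral_mul_comp_norm (volume : Measure (EuclideanSpace ℝ (Fin 3)))
    (fun x => x 2 ^ n) fun r => r ^ n * Real.exp (-r ^ 2)
  have hcart : ∀ x : EuclideanSpace ℝ (Fin 3),
      (‖x‖⁻¹ • x) 2 ^ n * (‖x‖ ^ n * Real.exp (-‖x‖ ^ 2)) = x 2 ^ n * Real.exp (-‖x‖ ^ 2) := by
    intro x
    rcases eq_or_ne x 0 with rfl | hx
    · rcases eq_or_ne n 0 with rfl | hn0 <;> simp [*]
    · have := norm_ne_zero_iff.2 hx
      simp only [PiLp.smul_apply, smul_eq_mul, mul_pow, inv_pow]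
      field_simp
  have hrad : ∫ r in Set.Ioi (0 : ℝ), r ^ 2 * (r ^ n * Real.exp (-r ^ 2)) =
      (n + 1) / 4 * Real.Gamma ((n + 1) / 2) := by
    have h := integral_Ioi_pow_mul_exp_neg_sq (2 + n)
    simp only [pow_add, mul_assoc] at h
    rw [h, show (((2 + n : ℕ) : ℝ) + 1) / 2 = (n + 1) / 2 + 1 by push_cast; ring,
      Real.Gamma_add_one (by positivity)]
    ring
  simp only [hcart, finrank_euclideanSpace_fin, Nat.add_one_sub_one, hrad,
    integral_height_pow_mul_exp_neg_norm_sq hn] at hpolar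
  have hΓ : Real.Gamma (((n : ℝ) + 1) / 2) ≠ 0 := (Real.Gamma_pos_of_pos (by positivity)).ne'
  rw [eq_div_iff (by positivity)]
  refine mul_right_cancel₀ hΓ ?_
  rw [sigma]
  linear_combination -4 * hpolar

theorem integral_height_pow (n : ℕ) :
    ∫ x : S2, x.1 2 ^ n ∂sigma = 2 * Real.pi * ∫ t in (-1 : ℝ)..1, t ^ n := by
  rw [integral_pow]
  rcases Nat.even_or_odd n with hn | hn
  · rw [integral_height_pow_of_even hn, hn.add_one.neg_one_pow]
    ring
  · have h := integral_sphereMap (LinearIsometryEquiv.neg ℝ).measurePreserving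
      fun x : S2 => x.1 2 ^ n
    simp only [sphereMap, LinearIsometryEquiv.coe_neg, PiLp.neg_apply, hn.neg_pow,
      integral_neg] at h
    rw [hn.add_one.neg_one_pow, one_pow, sub_self, zero_div, mul_zero]
    exact CharZero.neg_eq_self_iff.1 h

theorem continuous_coord (i : Fin 3) : Continuous fun x : S2 => x.1 i := by
  fun_prop

theorem memLp_of_continuous {F : Type*} [NormedAddCommGroup F] {f : S2 → F}
    (hf : Continuous f) (q : ℝ≥0∞) : MemLp f q sigma :=
  hf.memLp_of_hasCompactSupport (HasCompactSupport.of_compactSpace f)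

/-- Archimedes' hat-box theorem, for polynomial functions of the height. -/
theorem integral_eval_height (q : Polynomial ℝ) :
    ∫ x : S2, q.eval (x.1 2) ∂sigma = 2 * Real.pi * ∫ t in (-1 : ℝ)..1, q.eval t := by
  have hint : ∀ q : Polynomial ℝ, Integrable (fun x : S2 => q.eval (x.1 2)) sigma := fun q =>
    memLp_one_iff_integrable.1 (memLp_of_continuous (q.continuous.comp (continuous_coord 2)) 1)
  induction q using Polynomial.induction_on' with
  | add p q hp hq =>
    simp only [Polynomial.eval_add]
    rw [integral_add (hint p) (hint q), intervalIntegral.integral_add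
      (p.continuous.intervalIntegrable _ _) (q.continuous.intervalIntegrable _ _), hp, hq, mul_add]
  | monomial n a =>
    simp only [Polynomial.eval_monomial]
    rw [integral_const_mul, intervalIntegral.integral_const_mul, integral_height_pow]
    ring

end Archimedes

section SphericalHarmonics

/-- The rotation by the angle `φ` about the third axis. -/
noncomputable def rotation (φ : ℝ) :
    EuclideanSpace ℝ (Fin 3) ≃ₗᵢ[ℝ] EuclideanSpace ℝ (Fin 3) :=
  LinearIsometry.toLinearIsometryEquiv
    { toLinearMap := Matrix.toEuclideanLin
        !![Real.cos φ, -Real.sin φ, 0; Real.sin φ, Real.cos φ, 0; 0, 0, 1]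
      norm_map' := fun x => by
        simp only [EuclideanSpace.norm_eq, Real.norm_eq_abs, sq_abs, Matrix.toLpLin_apply,
          Matrix.mulVec, dotProduct, Fin.sum_univ_three]
        congr 1
        simp only [Matrix.of_apply, Matrix.cons_val', Matrix.cons_val_zero,
          Matrix.cons_val_fin_one, Matrix.cons_val_one, neg_mul, Matrix.cons_val, zero_mul,
          add_zero, one_mul, zero_add, add_left_inj]
        linear_combination (x.ofLp 0 ^ 2 + x.ofLp 1 ^ 2) * Real.sin_sq_add_cos_sq φ } rfl

theorem rotation_apply (φ : ℝ) (x : EuclideanSpace ℝ (Fin 3)) :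
    rotation φ x 0 = Real.cos φ * x 0 - Real.sin φ * x 1 ∧
    rotation φ x 1 = Real.sin φ * x 0 + Real.cos φ * x 1 ∧ rotation φ x 2 = x 2 := by
  simp [rotation, Matrix.toLpLin_apply, dotProduct, Fin.sum_univ_three, sub_eq_add_neg]

theorem sphHarmNat_rotation (φ : ℝ) (l m : ℕ) (x : S2) :
    sphHarmNat l m (sphereMap (rotation φ) x) =
      Complex.exp (φ * Complex.I) ^ m * sphHarmNat l m x := by
  obtain ⟨h0, h1, h2⟩ := rotation_apply φ x.1
  have h : (((Real.cos φ * x.1 0 - Real.sin φ * x.1 1 : ℝ) : ℂ) +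
      Complex.I * ((Real.sin φ * x.1 0 + Real.cos φ * x.1 1 : ℝ) : ℂ)) =
      Complex.exp (φ * Complex.I) * (((x.1 0 : ℝ) : ℂ) + Complex.I * ((x.1 1 : ℝ) : ℂ)) := by
    rw [Complex.exp_mul_I]
    push_cast
    linear_combination (-Complex.sin φ * x.1 1) * Complex.I_sq
  simp only [sphHarmNat, sphereMap, h0, h1, h2]
  rw [h, mul_pow]
  ring

theorem sphHarm_rotation (φ : ℝ) (l : ℕ) (m : ℤ) (x : S2) :
    sphHarm l m (sphereMap (rotation φ) x) = Complex.exp (m * φ * Complex.I) * sphHarm l m x := by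
  unfold sphHarm
  split_ifs with h
  · have habs : (m.natAbs : ℂ) = m := by rw [← Int.cast_natCast, Int.natAbs_of_nonneg h]
    rw [sphHarmNat_rotation, ← Complex.exp_nat_mul, habs, mul_assoc]
  · have habs : (m.natAbs : ℂ) = -m := by
      rw [← Int.cast_natCast, Int.ofNat_natAbs_of_nonpos (not_le.1 h).le, Int.cast_neg]
    rw [sphHarmNat_rotation, ← Complex.exp_nat_mul, map_mul, ← Complex.exp_conj]
    simp only [map_mul, habs, map_neg, Complex.conj_I, Complex.conj_ofReal, map_intCast]
    ring_nf

theorem continuous_sphHarmNat (l m : ℕ) : Continuous (sphHarmNat l m) := by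
  have h := (Polynomial.derivative^[m] (legendre l)).continuous.comp (continuous_coord 2)
  simp only [Function.comp_def] at h
  unfold sphHarmNat
  fun_prop

theorem continuous_sphHarm (l : ℕ) (m : ℤ) : Continuous (sphHarm l m) := by
  unfold sphHarm
  split_ifs
  · exact continuous_sphHarmNat l _
  · exact continuous_const.mul (Complex.continuous_conj.comp (continuous_sphHarmNat l _))

theorem integral_conj_sphHarm_mul_of_order_ne (l l' : ℕ) {m m' : ℤ} (h : m ≠ m') :
    ∫ x, conj (sphHarm l m x) * sphHarm l' m' x ∂sigma = 0 := by
  have hne : (m' : ℂ) - m ≠ 0 := by exact_mod_cast sub_ne_zero.2 h.symm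
  -- The rotation by `π / (m' - m)` multiplies the integrand by `exp (i π) = -1`.
  set φ : ℝ := Real.pi / (m' - m) with hφ
  have hphase : Complex.exp (conj (m * φ * Complex.I)) * Complex.exp (m' * φ * Complex.I) = -1 := by
    rw [← Complex.exp_add, ← Complex.exp_pi_mul_I]
    congr 1
    simp only [map_mul, Complex.conj_I, Complex.conj_ofReal, map_intCast, hφ]
    push_cast
    field_simp
    ring
  have hneg : ∀ x, conj (sphHarm l m (sphereMap (rotation φ) x)) *
      sphHarm l' m' (sphereMap (rotation φ) x) = -(conj (sphHarm l m x) * sphHarm l' m' x) := by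
    intro x
    rw [sphHarm_rotation, sphHarm_rotation, map_mul, ← Complex.exp_conj]
    linear_combination (conj (sphHarm l m x) * sphHarm l' m' x) * hphase
  have hrot := integral_sphereMap (rotation φ).measurePreserving
    fun x : S2 => conj (sphHarm l m x) * sphHarm l' m' x
  simp only [hneg, integral_neg] at hrot
  exact CharZero.neg_eq_self_iff.mp hrot

/-- The normalization constant of the spherical harmonics of degree `l` and order `± m`. -/
noncomputable def sphNorm (l m : ℕ) : ℝ :=
  Real.sqrt ((2 * l + 1) / (4 * Real.pi) * (((l - m).factorial : ℝ) / ((l + m).factorial : ℝ)))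

theorem conj_mul_self_horizontal (x : S2) :
    conj (((x.1 0 : ℝ) : ℂ) + Complex.I * ((x.1 1 : ℝ) : ℂ)) *
      (((x.1 0 : ℝ) : ℂ) + Complex.I * ((x.1 1 : ℝ) : ℂ)) = ((1 - x.1 2 ^ 2 : ℝ) : ℂ) := by
  have hx : x.1 0 ^ 2 + x.1 1 ^ 2 + x.1 2 ^ 2 = 1 := by
    have h := EuclideanSpace.norm_sq_eq x.1
    rw [norm_eq_of_mem_sphere, Fin.sum_univ_three] at h
    simpa using h.symm
  rw [show 1 - x.1 2 ^ 2 = x.1 0 ^ 2 + x.1 1 ^ 2 by linarith]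
  simp only [map_add, map_mul, Complex.conj_I, Complex.conj_ofReal]
  push_cast
  linear_combination (-(x.1 1 : ℂ) ^ 2) * Complex.I_sq

open Polynomial in
theorem conj_sphHarmNat_mul (l l' m : ℕ) (x : S2) :
    conj (sphHarmNat l m x) * sphHarmNat l' m x =
      ((sphNorm l m * sphNorm l' m * ((1 - X ^ 2) ^ m *
        (derivative^[m] (legendre l) * derivative^[m] (legendre l'))).eval (x.1 2) : ℝ) : ℂ) := by
  have hsign : ((-1 : ℂ) ^ m) * (-1) ^ m = 1 := by rw [← mul_pow]; simp
  simp only [sphHarmNat, ← sphNorm.eq_def, map_mul, map_pow, map_neg, map_one, Complex.conj_ofReal,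
    eval_mul, eval_pow, eval_sub, eval_one, eval_X, Complex.ofReal_mul, Complex.ofReal_pow]
  rw [← conj_mul_self_horizontal, mul_pow]
  linear_combination
    ((conj (((x.1 0 : ℝ) : ℂ) + Complex.I * ((x.1 1 : ℝ) : ℂ))) ^ m *
      (((x.1 0 : ℝ) : ℂ) + Complex.I * ((x.1 1 : ℝ) : ℂ)) ^ m *
      (sphNorm l m : ℂ) * (sphNorm l' m : ℂ) *
      (((derivative^[m] (legendre l)).eval (x.1 2) : ℝ) : ℂ) *
      (((derivative^[m] (legendre l')).eval (x.1 2) : ℝ) : ℂ)) * hsign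

theorem conj_sphHarm_mul (l l' : ℕ) (m : ℤ) (x : S2) :
    conj (sphHarm l m x) * sphHarm l' m x =
      conj (sphHarmNat l m.natAbs x) * sphHarmNat l' m.natAbs x := by
  unfold sphHarm
  split_ifs with h
  · rfl
  · have hsign : ((-1 : ℂ) ^ m.natAbs) * (-1) ^ m.natAbs = 1 := by rw [← mul_pow]; simp
    have hreal : sphHarmNat l m.natAbs x * conj (sphHarmNat l' m.natAbs x) =
        conj (sphHarmNat l m.natAbs x) * sphHarmNat l' m.natAbs x := by
      have h := congrArg conj (conj_sphHarmNat_mul l l' m.natAbs x)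
      rwa [Complex.conj_ofReal, ← conj_sphHarmNat_mul, map_mul, Complex.conj_conj] at h
    rw [← hreal]
    simp only [map_mul, map_pow, map_neg, map_one, Complex.conj_conj]
    linear_combination (sphHarmNat l m.natAbs x * conj (sphHarmNat l' m.natAbs x)) * hsign

theorem integral_conj_sphHarm_mul_same_order (l l' : ℕ) (m : ℤ) :
    ∫ x, conj (sphHarm l m x) * sphHarm l' m x ∂sigma =
      ((sphNorm l m.natAbs * sphNorm l' m.natAbs *
        (2 * Real.pi * legendreInner m.natAbs l l') : ℝ) : ℂ) := by
  simp only [conj_sphHarm_mul, conj_sphHarmNat_mul]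
  rw [integral_complex_ofReal, integral_const_mul, integral_eval_height, legendreInner]

theorem integral_conj_sphHarm_mul_of_degree_ne {l l' : ℕ} (h : l ≠ l') (m m' : ℤ) :
    ∫ x, conj (sphHarm l m x) * sphHarm l' m' x ∂sigma = 0 := by
  rcases eq_or_ne m m' with rfl | hm
  · rw [integral_conj_sphHarm_mul_same_order, legendreInner_of_ne h]
    simp
  · exact integral_conj_sphHarm_mul_of_order_ne l l' hm

theorem integral_conj_sphHarm_mul_self {l : ℕ} {m : ℤ} (hm : m.natAbs ≤ l) :
    ∫ x, conj (sphHarm l m x) * sphHarm l m x ∂sigma = 1 := by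
  rw [integral_conj_sphHarm_mul_same_order, legendreInner_self hm, sphNorm,
    Real.mul_self_sqrt (by positivity)]
  norm_cast
  field_simp
  norm_num

theorem integral_conj_sphHarm_mul (i j : Σ l : ℕ, Orders l) :
    ∫ x, conj (sphHarm i.1 i.2 x) * sphHarm j.1 j.2 x ∂sigma = if i = j then 1 else 0 := by
  obtain ⟨l, m, hm⟩ := i
  obtain ⟨l', m', hm'⟩ := j
  rcases eq_or_ne l l' with rfl | hl
  · rcases eq_or_ne m m' with rfl | hmm
    · rw [if_pos rfl]
      have hml : m.natAbs ≤ l := by rw [Finset.mem_Icc] at hm; omega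
      exact integral_conj_sphHarm_mul_self hml
    · rw [if_neg (by simpa using hmm)]
      exact integral_conj_sphHarm_mul_of_order_ne l l hmm
  · rw [if_neg fun h => hl (congrArg Sigma.fst h)]
    exact integral_conj_sphHarm_mul_of_degree_ne hl m m'

theorem continuous_degreePart (α : Coeff) (l : ℕ) : Continuous (degreePart α l) :=
  continuous_finsetSum _ fun m _ => continuous_const.mul (continuous_sphHarm l m)

theorem continuous_truncField (L : ℕ) (α : Coeff) : Continuous (truncField L α) :=
  continuous_finsetSum _ fun l _ => continuous_degreePart α l

end SphericalHarmonics

section InnerProduct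

variable {𝕜 H ι : Type*} [RCLike 𝕜] [SeminormedAddCommGroup H] [InnerProductSpace 𝕜 H]

theorem norm_sum_le_of_pairwise_inner_eq_zero {u : ι → H} {U : H} (hu : HasSum u U)
    (horth : Pairwise fun i j => inner 𝕜 (u i) (u j) = 0) (s : Finset ι) :
    ‖∑ i ∈ s, u i‖ ≤ ‖U‖ := by
  set S := ∑ i ∈ s, u i with hS
  have hSU : inner 𝕜 S U = inner 𝕜 S S := by
    have hzero : ∀ i ∉ s, inner 𝕜 S (u i) = 0 := fun i hi => by
      rw [hS, sum_inner]
      exact Finset.sum_eq_zero fun j hj => horth (ne_of_mem_of_not_mem hj hi)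
    have h : HasSum (fun i => inner 𝕜 S (u i)) (inner 𝕜 S U) := hu.mapL (innerSL 𝕜 S)
    rw [h.unique (hasSum_sum_of_ne_finset_zero hzero), ← inner_sum]
  have h : ‖S‖ ^ 2 ≤ ‖S‖ * ‖U‖ := by
    rw [← inner_self_eq_norm_sq (𝕜 := 𝕜), ← hSU]
    exact re_inner_le_norm S U
  rcases (norm_nonneg S).eq_or_lt with h0 | h0
  · rw [← h0]
    exact norm_nonneg U
  · exact le_of_mul_le_mul_left (by rwa [← sq]) h0

theorem norm_sub_le_norm_sum_sub {u : ι → H} {U t : H} (hu : HasSum u U)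
    (hres : ∀ i, RCLike.re (inner 𝕜 (u i) (U - t)) ≤ 0) (s : Finset ι) :
    ‖U - t‖ ≤ ‖∑ i ∈ s, u i - t‖ := by
  set S := ∑ i ∈ s, u i with hS
  have htail : RCLike.re (inner 𝕜 (U - S) (U - t)) ≤ 0 := by
    have hsum : HasSum (fun i => RCLike.re (inner 𝕜 (U - t) (u i)))
        (RCLike.re (inner 𝕜 (U - t) U)) :=
      (RCLike.hasSum_re 𝕜 (hu.mapL (innerSL 𝕜 (U - t))))
    have h := sum_le_hasSum s (fun i _ => neg_nonneg.2 (inner_re_symm (𝕜 := 𝕜) (u i) _ ▸ hres i))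
      hsum.neg
    rw [Finset.sum_neg_distrib, neg_le_neg_iff] at h
    rw [inner_re_symm, inner_sub_right, hS, inner_sum, map_sub, map_sum]
    exact sub_nonpos.2 h
  have hexp := norm_sub_sq (𝕜 := 𝕜) (U - t) (U - S)
  rw [sub_sub_sub_cancel_left, inner_re_symm] at hexp
  refine (sq_le_sq₀ (norm_nonneg _) (norm_nonneg _)).1 ?_
  nlinarith [sq_nonneg ‖U - S‖]

end InnerProduct

section SquareIntegrable

theorem inner_eq_integral {𝕜 X : Type*} [RCLike 𝕜] [MeasurableSpace X] {μ : Measure X}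
    {f g : X → 𝕜} {F G : Lp 𝕜 2 μ} (hf : F =ᵐ[μ] f) (hg : G =ᵐ[μ] g) :
    inner 𝕜 F G = ∫ x, conj (f x) * g x ∂μ := by
  rw [L2.inner_def]
  refine integral_congr_ae ?_
  filter_upwards [hf, hg] with x hfx hgx
  rw [hfx, hgx, RCLike.inner_apply']

variable {Γ : Set S2} (hΓ : MeasurableSet Γ)

/-- The inpainting operator `inpaint Γ` as a bounded operator on `L²`, realized as the
multiplication by the indicator function of `Γ`. -/
noncomputable def inpaintL2 : Lp ℂ 2 sigma →L[ℂ] Lp ℂ 2 sigma :=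
  (ContinuousLinearMap.mul ℂ ℂ).holderL sigma ∞ 2 2
    (indicatorConstLp ∞ hΓ (measure_ne_top sigma Γ) 1)

theorem coeFn_inpaintL2 (F : Lp ℂ 2 sigma) : inpaintL2 hΓ F =ᵐ[sigma] inpaint Γ F := by
  filter_upwards [ContinuousLinearMap.coeFn_holder (r := 2) (ContinuousLinearMap.mul ℂ ℂ)
    (indicatorConstLp ∞ hΓ (measure_ne_top sigma Γ) 1) F,
    indicatorConstLp_coeFn (p := ∞) (hs := hΓ) (hμs := measure_ne_top sigma Γ) (c := (1 : ℂ))]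
    with x hx hind
  refine hx.trans ?_
  rw [hind, inpaint]
  by_cases hxΓ : x ∈ Γ <;> simp [hxΓ]

theorem inner_inpaintL2_left {f g : S2 → ℂ} {F G : Lp ℂ 2 sigma} (hf : F =ᵐ[sigma] f)
    (hg : G =ᵐ[sigma] g) : inner ℂ (inpaintL2 hΓ F) G = ∫ x in Γ, conj (f x) * g x ∂sigma := by
  have hF : inpaintL2 hΓ F =ᵐ[sigma] inpaint Γ f :=
    (coeFn_inpaintL2 hΓ F).trans (hf.mono fun x hx => by simp only [inpaint, Set.indicator, hx])
  rw [inner_eq_integral hF hg, ← integral_indicator hΓ]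
  congr 1 with x
  by_cases hx : x ∈ Γ <;> simp [inpaint, hx]

theorem inner_inpaintL2_inpaintL2 (F G : Lp ℂ 2 sigma) :
    inner ℂ (inpaintL2 hΓ F) (inpaintL2 hΓ G) = inner ℂ (inpaintL2 hΓ F) G := by
  rw [inner_inpaintL2_left hΓ .rfl (coeFn_inpaintL2 hΓ G), inner_inpaintL2_left hΓ .rfl .rfl]
  refine setIntegral_congr_fun hΓ fun x hx => ?_
  simp only [inpaint, Set.indicator_of_mem hx]

end SquareIntegrable

section HarmonicSeries

/-- The spherical harmonic `Y_{l,m}` as an element of `L²`. -/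
noncomputable def sphHarmL2 (l : ℕ) (m : Orders l) : Lp ℂ 2 sigma :=
  (memLp_of_continuous (continuous_sphHarm l m) 2).toLp

theorem coeFn_sphHarmL2 (l : ℕ) (m : Orders l) : sphHarmL2 l m =ᵐ[sigma] sphHarm l m :=
  MemLp.coeFn_toLp _

theorem orthonormal_sphHarmL2 : Orthonormal ℂ fun i : Σ l, Orders l => sphHarmL2 i.1 i.2 := by
  classical
  rw [orthonormal_iff_ite]
  intro i j
  rw [inner_eq_integral (coeFn_sphHarmL2 _ _) (coeFn_sphHarmL2 _ _), integral_conj_sphHarm_mul]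

/-- The degree-`l` part of a field as an element of `L²`. -/
noncomputable def degreeL2 (α : Coeff) (l : ℕ) : Lp ℂ 2 sigma := ∑ m, α l m • sphHarmL2 l m

theorem coeFn_degreeL2 (α : Coeff) (l : ℕ) : degreeL2 α l =ᵐ[sigma] degreePart α l := by
  have h : ∀ᵐ x ∂sigma, ∀ m, (α l m • sphHarmL2 l m : Lp ℂ 2 sigma) x = α l m * sphHarm l m x := by
    refine ae_all_iff.2 fun m => ?_
    filter_upwards [Lp.coeFn_smul (α l m) (sphHarmL2 l m), coeFn_sphHarmL2 l m] with x h1 h2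
    rw [h1, Pi.smul_apply, h2, smul_eq_mul]
  filter_upwards [Lp.coeFn_fun_finsetSum Finset.univ fun m => α l m • sphHarmL2 l m, h]
    with x hx h
  rw [degreeL2, hx]
  exact Finset.sum_congr rfl fun m _ => h m

theorem norm_degreeL2 (α : Coeff) (l : ℕ) : ‖degreeL2 α l‖ = ‖α l‖ := by
  have h : inner ℂ (degreeL2 α l) (degreeL2 α l) = inner ℂ (α l) (α l) := by
    simp only [PiLp.inner_apply, RCLike.inner_apply']
    exact (orthonormal_sphHarmL2.comp (Sigma.mk l) sigma_mk_injective).inner_sum _ _ _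
  rw [norm_eq_sqrt_re_inner (𝕜 := ℂ), h, ← norm_eq_sqrt_re_inner (𝕜 := ℂ)]

theorem pairwise_inner_degreeL2 (α : Coeff) :
    Pairwise fun l l' => inner ℂ (degreeL2 α l) (degreeL2 α l') = 0 := by
  intro l l' hl
  simp only [degreeL2, sum_inner, inner_sum]
  refine Finset.sum_eq_zero fun m' _ => Finset.sum_eq_zero fun m _ => ?_
  rw [inner_smul_left, inner_smul_right,
    orthonormal_sphHarmL2.2 (i := ⟨l, m⟩) (j := ⟨l', m'⟩) fun h => hl (congrArg Sigma.fst h),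
    mul_zero, mul_zero]

/-- The sum in `L²` of the degree parts of a field. -/
noncomputable def fieldL2 (α : Coeff) : Lp ℂ 2 sigma := ∑' l, degreeL2 α l

variable {α : Coeff}

theorem hasSum_degreeL2 (h : Summable fun l => ‖α l‖) : HasSum (degreeL2 α) (fieldL2 α) :=
  (Summable.of_norm (by simpa only [norm_degreeL2] using h)).hasSum

theorem coeFn_fieldL2 (h : Summable fun l => ‖α l‖) : fieldL2 α =ᵐ[sigma] field α := by
  have hfin : ∑' l, ‖degreeL2 α l‖ₑ ≠ ∞ :=
    tsum_enorm_ne_top_iff_summable_norm.2 (by simpa only [norm_degreeL2] using h)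
  filter_upwards [Lp.coeFn_tsum hfin, ae_all_iff.2 (coeFn_degreeL2 α)] with x hx hdeg
  rw [fieldL2, hx]
  exact tsum_congr hdeg

theorem coeFn_sum_degreeL2 (α : Coeff) (L : ℕ) :
    (∑ l ∈ Finset.range (L + 1), degreeL2 α l : Lp ℂ 2 sigma) =ᵐ[sigma] truncField L α := by
  filter_upwards [Lp.coeFn_fun_finsetSum (Finset.range (L + 1)) (degreeL2 α),
    ae_all_iff.2 (coeFn_degreeL2 α)] with x hx hdeg
  rw [hx]
  exact Finset.sum_congr rfl fun l _ => hdeg l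

theorem enorm_eq_eLpNorm {X : Type*} [MeasurableSpace X] {μ : Measure X} {f : X → ℂ}
    {F : Lp ℂ 2 μ} (hf : F =ᵐ[μ] f) : ‖F‖ₑ = eLpNorm f 2 μ := by
  rw [Lp.enorm_def, eLpNorm_congr_ae hf]

theorem eLpNorm_truncField_le (h : Summable fun l => ‖α l‖) (L : ℕ) :
    eLpNorm (truncField L α) 2 sigma ≤ eLpNorm (field α) 2 sigma := by
  rw [← enorm_eq_eLpNorm (coeFn_sum_degreeL2 α L), ← enorm_eq_eLpNorm (coeFn_fieldL2 h)]
  exact enorm_le_iff_norm_le.2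
    (norm_sum_le_of_pairwise_inner_eq_zero (hasSum_degreeL2 h) (pairwise_inner_degreeL2 α) _)

end HarmonicSeries

section Weights

variable {η p : ℝ}

theorem weight_pos (hη : 0 < η) (l : ℕ) : 0 < weight η p l := by
  unfold weight
  split_ifs with h
  · exact one_pos
  · have : (0 : ℝ) < l := by exact_mod_cast Nat.pos_of_ne_zero h
    positivity

theorem rpow_le_weight (hη : 1 ≤ η) {l : ℕ} (hl : l ≠ 0) : (l : ℝ) ^ p ≤ weight η p l := by
  rw [weight, if_neg hl]
  exact le_mul_of_one_le_left (by positivity) (one_le_pow₀ hη)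

variable {α : Coeff}

theorem MemEll.summable_norm_of_le_one (hp0 : 0 < p) (hp1 : p ≤ 1) (hη : 1 ≤ η)
    (h : MemEll η p α) : Summable fun l => ‖α l‖ := by
  refine Summable.of_norm_bounded_eventually_nat h.2 ?_
  filter_upwards [h.1.tendsto_atTop_zero.eventually_le_const one_pos, Filter.eventually_ne_atTop 0]
    with l hα hl
  have hl1 : (1 : ℝ) ≤ l := by exact_mod_cast Nat.one_le_iff_ne_zero.2 hl
  rw [norm_norm]
  calc ‖α l‖ ≤ ‖α l‖ ^ p := Real.self_le_rpow_of_le_one (norm_nonneg _)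
        ((sq_le_one_iff₀ (norm_nonneg _)).1 hα) hp1
    _ ≤ weight η p l * ‖α l‖ ^ p := le_mul_of_one_le_left (by positivity)
        ((Real.one_le_rpow hl1 hp0.le).trans (rpow_le_weight hη hl))

theorem MemEll.summable_norm_of_one_lt (hp : 1 < p) (hη : 1 ≤ η) (h : MemEll η p α) :
    Summable fun l => ‖α l‖ := by
  have hpq := Real.HolderConjugate.conjExponent hp
  have hmul : Summable fun l : ℕ => ((l : ℝ) * ‖α l‖) ^ p := by
    refine h.2.of_nonneg_of_le (fun l => by positivity) fun l => ?_
    rw [Real.mul_rpow l.cast_nonneg (norm_nonneg _)]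
    rcases eq_or_ne l 0 with rfl | hl
    · rw [Nat.cast_zero, Real.zero_rpow (by positivity), zero_mul]
      exact mul_nonneg (weight_pos (one_pos.trans_le hη) 0).le (by positivity)
    · exact mul_le_mul_of_nonneg_right (rpow_le_weight hη hl) (by positivity)
  have hinv : Summable fun l : ℕ => (l : ℝ)⁻¹ ^ p.conjExponent := by
    simpa only [Real.inv_rpow (Nat.cast_nonneg _)] using
      Real.summable_nat_rpow_inv.2 hpq.symm.lt
  refine Summable.of_norm_bounded_eventually_nat (Real.summable_mul_of_Lp_Lq_of_nonneg hpq
    (fun l => by positivity) (fun l => by positivity) hmul hinv) ?_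
  filter_upwards [Filter.eventually_ne_atTop 0] with l hl
  rw [norm_norm, mul_right_comm, mul_inv_cancel₀ (Nat.cast_ne_zero.2 hl), one_mul]

theorem MemEll.summable_norm (hp : 0 < p) (hη : 1 ≤ η) (h : MemEll η p α) :
    Summable fun l => ‖α l‖ :=
  (le_or_gt p 1).elim (fun hp1 => h.summable_norm_of_le_one hp hp1 hη)
    fun hp1 => h.summable_norm_of_one_lt hp1 hη

end Weights

section Constraint

variable {Γ : Set S2} (hΓ : MeasurableSet Γ) {α : Coeff}

/-- The vector with entries `∫_Γ conj Y_{l,m} · v dσ`. -/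
noncomputable def coeffOn (v : Lp ℂ 2 sigma) : Coeff := fun l =>
  WithLp.toLp 2 fun m => inner ℂ (inpaintL2 hΓ (sphHarmL2 l m)) v

theorem inner_coeffOn (α : Coeff) (l : ℕ) (v : Lp ℂ 2 sigma) :
    inner ℂ (α l) (coeffOn hΓ v l) = inner ℂ (inpaintL2 hΓ (degreeL2 α l)) v := by
  simp only [degreeL2, map_sum, map_smul, sum_inner, inner_smul_left, PiLp.inner_apply, coeffOn,
    RCLike.inner_apply']

theorem coeffOn_sub (v w : Lp ℂ 2 sigma) (l : ℕ) :
    coeffOn hΓ (v - w) l = coeffOn hΓ v l - coeffOn hΓ w l := by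
  ext m
  simp only [coeffOn, inner_sub_right, PiLp.sub_apply]

theorem coeffOn_inpaintL2 (v : Lp ℂ 2 sigma) : coeffOn hΓ (inpaintL2 hΓ v) = coeffOn hΓ v := by
  ext l m
  simp only [coeffOn, inner_inpaintL2_inpaintL2]

theorem gramMul_eq_coeffOn (hα : Summable fun l => ‖α l‖) :
    gramMul Γ α = coeffOn hΓ (fieldL2 α) := by
  ext l m
  have hgram : ∀ l' (m' : Orders l'), gram Γ l m l' m' =
      inner ℂ (inpaintL2 hΓ (sphHarmL2 l m)) (sphHarmL2 l' m') := fun l' m' =>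
    (inner_inpaintL2_left hΓ (coeFn_sphHarmL2 l m) (coeFn_sphHarmL2 l' m')).symm
  have hsum : HasSum (fun l' => inner ℂ (inpaintL2 hΓ (sphHarmL2 l m)) (degreeL2 α l'))
      (inner ℂ (inpaintL2 hΓ (sphHarmL2 l m)) (fieldL2 α)) :=
    (hasSum_degreeL2 hα).mapL (innerSL ℂ _)
  simp only [gramMul, coeffOn, hgram, ← hsum.tsum_eq, degreeL2, inner_sum, inner_smul_right,
    mul_comm]

variable {To : S2 → ℝ} {t : Lp ℂ 2 sigma}

theorem obsCoeff_eq_coeffOn (ht : t =ᵐ[sigma] fun x => (To x : ℂ)) :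
    obsCoeff Γ To = coeffOn hΓ t := by
  ext l m
  simp only [obsCoeff, coeffOn, inner_inpaintL2_left hΓ (coeFn_sphHarmL2 l m) ht, mul_comm]

theorem hdot_coeffOn (hα : Summable fun l => ‖α l‖) (v : Lp ℂ 2 sigma) :
    hdot α (coeffOn hΓ v) = inner ℂ (inpaintL2 hΓ (fieldL2 α)) v := by
  have hterm : ∀ l, ∑ m, conj (α l m) * coeffOn hΓ v l m =
      inner ℂ (inpaintL2 hΓ (degreeL2 α l)) v := fun l => by
    simp only [← inner_coeffOn, PiLp.inner_apply, RCLike.inner_apply']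
  have hsum : HasSum (fun l => inner ℂ (inpaintL2 hΓ (degreeL2 α l)) v)
      (inner ℂ (inpaintL2 hΓ (fieldL2 α)) v) := by
    have h := (((hasSum_degreeL2 hα).mapL (inpaintL2 hΓ)).mapL (innerSL ℂ v)).star
    simpa only [innerSL_apply_apply, RCLike.star_def, inner_conj_symm] using h
  simp only [hdot, hterm, hsum.tsum_eq]

theorem constraintFn_eq_norm_sq (hα : Summable fun l => ‖α l‖)
    (ht : t =ᵐ[sigma] fun x => (To x : ℂ)) :
    constraintFn Γ To α = ‖inpaintL2 hΓ (fieldL2 α) - t‖ ^ 2 := by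
  have hquad : (hdot α (gramMul Γ α)).re = ‖inpaintL2 hΓ (fieldL2 α)‖ ^ 2 := by
    rw [gramMul_eq_coeffOn hΓ hα, hdot_coeffOn hΓ hα, ← inner_inpaintL2_inpaintL2]
    exact inner_self_eq_norm_sq (𝕜 := ℂ) _
  have hconst : ∫ x, To x ^ 2 ∂sigma = ‖t‖ ^ 2 := by
    have h : inner ℂ t t = ((∫ x, To x ^ 2 ∂sigma : ℝ) : ℂ) := by
      rw [inner_eq_integral ht ht, ← integral_complex_ofReal]
      simp only [Complex.conj_ofReal, Complex.ofReal_mul, sq]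
    rw [← inner_self_eq_norm_sq (𝕜 := ℂ), h, RCLike.re_eq_complex_re, Complex.ofReal_re]
  rw [constraintFn, hquad, obsCoeff_eq_coeffOn hΓ ht, hdot_coeffOn hΓ hα, hconst,
    norm_sub_sq (𝕜 := ℂ), RCLike.re_eq_complex_re]

end Constraint

section KKT

theorem re_inner_nonpos_of_smul_add_smul_eq_zero {𝕜 H : Type*} [RCLike 𝕜] [NormedAddCommGroup H]
    [InnerProductSpace 𝕜 H] [Module ℝ H] [IsScalarTower ℝ 𝕜 H] {c d : ℝ} {a w : H} (hc : 0 < c)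
    (hd : 0 ≤ d) (h : c • a + d • w = 0) : RCLike.re (inner 𝕜 a w) ≤ 0 := by
  have hre : c * ‖a‖ ^ 2 + d * RCLike.re (inner 𝕜 a w) = 0 := by
    have := congrArg (fun v => RCLike.re (inner 𝕜 a v)) h
    simpa only [inner_add_right, inner_smul_right_eq_smul, map_add, RCLike.smul_re,
      inner_self_eq_norm_sq, inner_zero_right, map_zero] using this
  by_contra! hpos
  have ha : a ≠ 0 := by
    rintro rfl
    simp at hpos
  have : 0 < ‖a‖ := norm_pos_iff.2 ha
  exact (add_pos_of_pos_of_nonneg (by positivity) (by positivity)).ne' hre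

variable {η p rho : ℝ} {Γ : Set S2} {To : S2 → ℝ} {α : Coeff}

theorem IsScaledKKT.constraintFn_eq (hp : 0 < p) (hη : 0 < η) (hrho : rho < ∫ x, To x ^ 2 ∂sigma)
    (h : IsScaledKKT η p rho Γ To α) : constraintFn Γ To α = rho := by
  obtain ⟨-, ν, hstat, hcomp, hle, -⟩ := h
  rcases mul_eq_zero.1 hcomp with rfl | hactive
  · have hα : ∀ l, α l = 0 := fun l => by
      by_contra hne
      have hpow : 0 < ‖α l‖ ^ p := Real.rpow_pos_of_pos (norm_pos_iff.2 hne) p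
      have hl := hstat l
      rw [mul_zero, zero_mul, zero_smul, add_zero, smul_eq_zero] at hl
      exact hl.elim (mul_pos (mul_pos hp (weight_pos hη l)) hpow).ne' hne
    have hzero : constraintFn Γ To α = ∫ x, To x ^ 2 ∂sigma := by simp [constraintFn, hdot, hα]
    exact absurd hle (hzero ▸ not_le.2 hrho)
  · exact sub_eq_zero.1 hactive

variable (hΓ : MeasurableSet Γ) {t : Lp ℂ 2 sigma}

theorem IsScaledKKT.re_inner_residual_nonpos (hp : 0 < p) (hη : 1 ≤ η)
    (ht : t =ᵐ[sigma] fun x => (To x : ℂ)) (h : IsScaledKKT η p rho Γ To α) (l : ℕ) :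
    RCLike.re (inner ℂ (inpaintL2 hΓ (degreeL2 α l)) (inpaintL2 hΓ (fieldL2 α) - t)) ≤ 0 := by
  obtain ⟨hmem, ν, hstat, -, -, hν⟩ := h
  have hres : gramMul Γ α l - obsCoeff Γ To l = coeffOn hΓ (inpaintL2 hΓ (fieldL2 α) - t) l := by
    rw [gramMul_eq_coeffOn hΓ (hmem.summable_norm hp hη), obsCoeff_eq_coeffOn hΓ ht, coeffOn_sub,
      coeffOn_inpaintL2]
  rw [← inner_coeffOn, ← hres]
  rcases eq_or_ne (α l) 0 with h0 | h0
  · simp [h0]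
  · have hpow : 0 < ‖α l‖ ^ p := Real.rpow_pos_of_pos (norm_pos_iff.2 h0) p
    have hw : 0 < weight η p l := weight_pos (one_pos.trans_le hη) l
    exact re_inner_nonpos_of_smul_add_smul_eq_zero (𝕜 := ℂ) (mul_pos (mul_pos hp hw) hpow)
      (by positivity) (hstat l)

/-- The misfit `𝒜(T_L) - T°` of the truncated field `T_L`. -/
noncomputable def truncMisfit (Γ : Set S2) (To : S2 → ℝ) (α : Coeff) (L : ℕ) (x : S2) : ℂ :=
  inpaint Γ (truncField L α) x - (To x : ℂ)

theorem enorm_inpaintL2_sum_sub (ht : t =ᵐ[sigma] fun x => (To x : ℂ)) (α : Coeff) (L : ℕ) :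
    ‖inpaintL2 hΓ (∑ l ∈ Finset.range (L + 1), degreeL2 α l) - t‖ₑ =
      eLpNorm (truncMisfit Γ To α L) 2 sigma := by
  refine enorm_eq_eLpNorm ?_
  filter_upwards [Lp.coeFn_sub (inpaintL2 hΓ (∑ l ∈ Finset.range (L + 1), degreeL2 α l)) t,
    coeFn_inpaintL2 hΓ (∑ l ∈ Finset.range (L + 1), degreeL2 α l), coeFn_sum_degreeL2 α L, ht]
    with x hsub hinp hsum ht
  simp only [hsub, Pi.sub_apply, hinp, ht, truncMisfit, inpaint, Set.indicator, hsum]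

theorem IsScaledKKT.norm_misfit_sq (hp : 0 < p) (hη : 1 ≤ η)
    (hrho : rho < ∫ x, To x ^ 2 ∂sigma) (ht : t =ᵐ[sigma] fun x => (To x : ℂ))
    (h : IsScaledKKT η p rho Γ To α) : ‖inpaintL2 hΓ (fieldL2 α) - t‖ ^ 2 = rho := by
  rw [← constraintFn_eq_norm_sq hΓ (h.1.summable_norm hp hη) ht,
    h.constraintFn_eq hp (one_pos.trans_le hη) hrho]

include hΓ

theorem IsScaledKKT.rho_nonneg (hp : 0 < p) (hη : 1 ≤ η) (hTo : MemLp To 2 sigma)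
    (hrho : rho < ∫ x, To x ^ 2 ∂sigma) (h : IsScaledKKT η p rho Γ To α) : 0 ≤ rho :=
  h.norm_misfit_sq hΓ hp hη hrho hTo.ofReal.coeFn_toLp ▸ sq_nonneg _

theorem IsScaledKKT.ofReal_le_eLpNorm_truncMisfit_sq (hp : 0 < p) (hη : 1 ≤ η)
    (hTo : MemLp To 2 sigma) (hrho : rho < ∫ x, To x ^ 2 ∂sigma)
    (h : IsScaledKKT η p rho Γ To α) (L : ℕ) :
    ENNReal.ofReal rho ≤ eLpNorm (truncMisfit Γ To α L) 2 sigma ^ 2 := by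
  obtain ⟨t, ht⟩ : ∃ t : Lp ℂ 2 sigma, t =ᵐ[sigma] fun x => (To x : ℂ) :=
    ⟨_, hTo.ofReal.coeFn_toLp⟩
  have hle := norm_sub_le_norm_sum_sub
    ((hasSum_degreeL2 (h.1.summable_norm hp hη)).mapL (inpaintL2 hΓ))
    (h.re_inner_residual_nonpos hΓ hp hη ht) (Finset.range (L + 1))
  rw [← enorm_inpaintL2_sum_sub hΓ ht, ← h.norm_misfit_sq hΓ hp hη hrho ht,
    ENNReal.ofReal_pow (norm_nonneg _), ofReal_norm, map_sum]
  gcongr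
  exact enorm_le_iff_norm_le.2 hle

theorem IsScaledKKT.tendsto_eLpNorm_truncMisfit_sq (hp : 0 < p) (hη : 1 ≤ η)
    (hTo : MemLp To 2 sigma) (hrho : rho < ∫ x, To x ^ 2 ∂sigma)
    (h : IsScaledKKT η p rho Γ To α) :
    Filter.Tendsto (fun L => eLpNorm (truncMisfit Γ To α L) 2 sigma ^ 2) Filter.atTop
      (nhds (ENNReal.ofReal rho)) := by
  obtain ⟨t, ht⟩ : ∃ t : Lp ℂ 2 sigma, t =ᵐ[sigma] fun x => (To x : ℂ) :=
    ⟨_, hTo.ofReal.coeFn_toLp⟩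
  have hsum : Filter.Tendsto (fun L => ∑ l ∈ Finset.range (L + 1), degreeL2 α l) Filter.atTop
      (nhds (fieldL2 α)) :=
    (hasSum_degreeL2 (h.1.summable_norm hp hη)).tendsto_sum_nat.comp
      (Filter.tendsto_add_atTop_nat 1)
  have hlim := ((((inpaintL2 hΓ).continuous.tendsto _).comp hsum).sub_const t).enorm
  rw [← h.norm_misfit_sq hΓ hp hη hrho ht, ENNReal.ofReal_pow (norm_nonneg _), ofReal_norm]
  simpa only [Function.comp_def, enorm_inpaintL2_sum_sub hΓ ht] using ENNReal.Tendsto.pow hlim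

end KKT

section ProductNorm

variable {X Y F : Type*} [MeasurableSpace X] [MeasurableSpace Y] [NormedAddCommGroup F]
  {μ : Measure X} {ν : Measure Y} [SFinite ν] {f : X × Y → F}

theorem aemeasurable_eLpNorm_rpow_slice (hf : AEStronglyMeasurable f (μ.prod ν)) {q : ℝ≥0}
    (hq : q ≠ 0) : AEMeasurable (fun x => eLpNorm (fun y => f (x, y)) q ν ^ (q : ℝ)) μ := by
  simpa only [eLpNorm_nnreal_pow_eq_lintegral hq] using
    (hf.enorm.pow_const (q : ℝ)).lintegral_prod_right'

theorem eLpNorm_prod_rpow (hf : AEStronglyMeasurable f (μ.prod ν)) {q : ℝ≥0} (hq : q ≠ 0) :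
    eLpNorm f q (μ.prod ν) ^ (q : ℝ) = ∫⁻ x, eLpNorm (fun y => f (x, y)) q ν ^ (q : ℝ) ∂μ := by
  simp only [eLpNorm_nnreal_pow_eq_lintegral hq]
  exact lintegral_prod _ (hf.enorm.pow_const (q : ℝ))

theorem aemeasurable_eLpNorm_two_sq_slice (hf : AEStronglyMeasurable f (μ.prod ν)) :
    AEMeasurable (fun x => eLpNorm (fun y => f (x, y)) 2 ν ^ 2) μ := by
  simpa using aemeasurable_eLpNorm_rpow_slice hf two_ne_zero

theorem eLpNorm_two_prod_sq (hf : AEStronglyMeasurable f (μ.prod ν)) :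
    eLpNorm f 2 (μ.prod ν) ^ 2 = ∫⁻ x, eLpNorm (fun y => f (x, y)) 2 ν ^ 2 ∂μ := by
  simpa using eLpNorm_prod_rpow hf two_ne_zero

theorem ae_memLp_two_slice (hf : MemLp f 2 (μ.prod ν)) [SFinite μ] :
    ∀ᵐ x ∂μ, MemLp (fun y => f (x, y)) 2 ν := by
  have hfin : ∫⁻ x, eLpNorm (fun y => f (x, y)) 2 ν ^ 2 ∂μ ≠ ∞ :=
    eLpNorm_two_prod_sq hf.1 ▸ ENNReal.pow_ne_top hf.2.ne
  filter_upwards [hf.1.prodMk_left, ae_lt_top' (aemeasurable_eLpNorm_two_sq_slice hf.1) hfin]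
    with x hmeas hlt
  exact ⟨hmeas, (ENNReal.pow_lt_top_iff.1 hlt).resolve_right two_ne_zero⟩

end ProductNorm

section RandomField

theorem memLp_field {α : Coeff} (h : Summable fun l => ‖α l‖) : MemLp (field α) 2 sigma :=
  (Lp.memLp (fieldL2 α)).ae_eq (coeFn_fieldL2 h)

theorem memLp_truncField (α : Coeff) (L : ℕ) : MemLp (truncField L α) 2 sigma :=
  memLp_of_continuous (continuous_truncField L α) 2

theorem eLpNorm_truncMisfit_le {Γ : Set S2} (hΓ : MeasurableSet Γ) {To : S2 → ℝ}
    (hTo : MemLp To 2 sigma) {α : Coeff} (hα : Summable fun l => ‖α l‖) (L : ℕ) :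
    eLpNorm (truncMisfit Γ To α L) 2 sigma ≤
      eLpNorm (field α) 2 sigma + eLpNorm To 2 sigma := by
  have hTo' : eLpNorm (fun x => (To x : ℂ)) 2 sigma = eLpNorm To 2 sigma :=
    eLpNorm_congr_norm_ae (.of_forall fun x => by simp)
  calc eLpNorm (truncMisfit Γ To α L) 2 sigma
      ≤ eLpNorm (inpaint Γ (truncField L α)) 2 sigma + eLpNorm (fun x => (To x : ℂ)) 2 sigma :=
        eLpNorm_sub_le ((memLp_truncField α L).1.indicator hΓ)
          (Complex.continuous_ofReal.comp_aestronglyMeasurable hTo.1) one_le_two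
    _ ≤ eLpNorm (field α) 2 sigma + eLpNorm To 2 sigma := by
        rw [hTo']
        gcongr
        exact (eLpNorm_indicator_le _).trans (eLpNorm_truncField_le hα L)

variable {Ω : Type*} [MeasurableSpace Ω] {P : Measure Ω} {α : Ω → Coeff}

theorem measurable_truncField (hα : ∀ l m, Measurable fun ω => α ω l m) (L : ℕ) :
    Measurable fun z : Ω × S2 => truncField L (α z.1) z.2 :=
  Finset.measurable_fun_sum _ fun l _ => Finset.measurable_fun_sum _ fun m _ =>
    ((hα l m).comp measurable_fst).mul ((continuous_sphHarm l m).measurable.comp measurable_snd)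

theorem aestronglyMeasurable_truncMisfit {Γ : Set S2} (hΓ : MeasurableSet Γ)
    (hα : ∀ l m, Measurable fun ω => α ω l m) {To : Ω → S2 → ℝ}
    (hTo : AEStronglyMeasurable (fun z : Ω × S2 => To z.1 z.2) (P.prod sigma)) (L : ℕ) :
    AEStronglyMeasurable (fun z : Ω × S2 => truncMisfit Γ (To z.1) (α z.1) L z.2)
      (P.prod sigma) :=
  ((measurable_truncField hα L).indicator (measurable_snd hΓ)).aestronglyMeasurable.sub
    (Complex.continuous_ofReal.comp_aestronglyMeasurable hTo)

theorem exists_memLp_eLpNorm_field_le [IsProbabilityMeasure P]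
    (hα : ∀ᵐ ω ∂P, Summable fun l => ‖α ω l‖) {E : Type*} [SeminormedAddCommGroup E] {ξ : Ω → E}
    (hξ : MemLp (fun ω => ‖ξ ω‖) 2 P) {κ : ℝ≥0}
    (hLip : ∀ᵐ ω₁ ∂P, ∀ᵐ ω₂ ∂P,
      eLpNorm (fun x => field (α ω₁) x - field (α ω₂) x) 2 sigma ≤ κ * ‖ξ ω₁ - ξ ω₂‖ₑ) :
    ∃ g : Ω → ℝ, MemLp g 2 P ∧ ∀ᵐ ω ∂P, eLpNorm (field (α ω)) 2 sigma ≤ ‖g ω‖ₑ := by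
  obtain ⟨ω₁, hω₁, hLip₁⟩ := (hα.and hLip).exists
  refine ⟨fun ω => ‖fieldL2 (α ω₁)‖ + κ * (‖ξ ω₁‖ + ‖ξ ω‖),
    (memLp_const ‖fieldL2 (α ω₁)‖).add (((memLp_const ‖ξ ω₁‖).add hξ).const_mul (κ : ℝ)), ?_⟩
  filter_upwards [hα, hLip₁] with ω hω hdist
  have hsplit : field (α ω) = field (α ω₁) - (field (α ω₁) - field (α ω)) := by abel
  calc eLpNorm (field (α ω)) 2 sigma
      ≤ eLpNorm (field (α ω₁)) 2 sigma + eLpNorm (field (α ω₁) - field (α ω)) 2 sigma := by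
        conv_lhs => rw [hsplit]
        exact eLpNorm_sub_le (memLp_field hω₁).1 ((memLp_field hω₁).sub (memLp_field hω)).1
          one_le_two
    _ ≤ ‖fieldL2 (α ω₁)‖ₑ + κ * (‖ξ ω₁‖ₑ + ‖ξ ω‖ₑ) := by
        rw [enorm_eq_eLpNorm (coeFn_fieldL2 hω₁)]
        gcongr
        exact hdist.trans (by gcongr; exact enorm_sub_le)
    _ = ‖‖fieldL2 (α ω₁)‖ + κ * (‖ξ ω₁‖ + ‖ξ ω‖)‖ₑ := by
        rw [Real.enorm_of_nonneg (by positivity),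
          ENNReal.ofReal_add (by positivity) (by positivity),
          ENNReal.ofReal_mul κ.coe_nonneg, ENNReal.ofReal_add (by positivity) (by positivity)]
        simp only [ofReal_norm, ENNReal.ofReal_coe_nnreal]

theorem tendsto_eLpNorm_prod_truncMisfit_sq [SFinite P] {Γ : Set S2} (hΓ : MeasurableSet Γ)
    (hα_meas : ∀ l m, Measurable fun ω => α ω l m)
    (hα : ∀ᵐ ω ∂P, Summable fun l => ‖α ω l‖) {To : Ω → S2 → ℝ}
    (hTo : MemLp (fun z : Ω × S2 => To z.1 z.2) 2 (P.prod sigma)) {g : Ω → ℝ} (hg : MemLp g 2 P)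
    (hαg : ∀ᵐ ω ∂P, eLpNorm (field (α ω)) 2 sigma ≤ ‖g ω‖ₑ) {c : Ω → ℝ≥0∞}
    (hlim : ∀ᵐ ω ∂P, Filter.Tendsto
      (fun L => eLpNorm (truncMisfit Γ (To ω) (α ω) L) 2 sigma ^ 2) Filter.atTop (nhds (c ω))) :
    Filter.Tendsto (fun L => eLpNorm (fun z : Ω × S2 => truncMisfit Γ (To z.1) (α z.1) L z.2) 2
      (P.prod sigma) ^ 2) Filter.atTop (nhds (∫⁻ ω, c ω ∂P)) := by
  have hmeas := aestronglyMeasurable_truncMisfit hΓ hα_meas hTo.1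
  have hsq : ∀ a b : ℝ≥0∞, (a + b) ^ 2 ≤ 2 * (a ^ 2 + b ^ 2) := fun a b => by
    simpa [show (2 : ℝ) - 1 = 1 by norm_num] using
      ENNReal.rpow_add_le_mul_rpow_add_rpow a b one_le_two
  have hdom : ∀ L, ∀ᵐ ω ∂P, eLpNorm (truncMisfit Γ (To ω) (α ω) L) 2 sigma ^ 2 ≤
      2 * (‖g ω‖ₑ ^ 2 + eLpNorm (To ω) 2 sigma ^ 2) := fun L => by
    filter_upwards [hα, hαg, ae_memLp_two_slice hTo] with ω hω hgω hToω
    refine le_trans ?_ (hsq _ _)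
    gcongr
    exact (eLpNorm_truncMisfit_le hΓ hToω hω L).trans (by gcongr)
  have hg_fin : ∫⁻ ω, ‖g ω‖ₑ ^ 2 ∂P ≠ ∞ := by
    have hg_sq : eLpNorm g 2 P ^ 2 = ∫⁻ ω, ‖g ω‖ₑ ^ 2 ∂P := by
      simpa using eLpNorm_nnreal_pow_eq_lintegral (f := g) (μ := P) (p := 2) two_ne_zero
    exact hg_sq ▸ ENNReal.pow_ne_top hg.2.ne
  have hfin : ∫⁻ ω, 2 * (‖g ω‖ₑ ^ 2 + eLpNorm (To ω) 2 sigma ^ 2) ∂P ≠ ∞ := by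
    rw [lintegral_const_mul' _ _ ENNReal.ofNat_ne_top,
      lintegral_add_left' (hg.1.enorm.pow_const 2), ← eLpNorm_two_prod_sq hTo.1]
    exact ENNReal.mul_ne_top ENNReal.ofNat_ne_top
      (ENNReal.add_ne_top.2 ⟨hg_fin, ENNReal.pow_ne_top hTo.2.ne⟩)
  simp only [eLpNorm_two_prod_sq (hmeas _)]
  exact tendsto_lintegral_of_dominated_convergence' _
    (fun L => (aemeasurable_eLpNorm_two_sq_slice (hmeas L) :)) hdom hfin hlim

theorem ofReal_le_eLpNorm_prod_truncMisfit_sq [IsProbabilityMeasure P] {Γ : Set S2}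
    (hΓ : MeasurableSet Γ) (hα_meas : ∀ l m, Measurable fun ω => α ω l m) {To : Ω → S2 → ℝ}
    (hTo : MemLp (fun z : Ω × S2 => To z.1 z.2) 2 (P.prod sigma)) {p η rho : ℝ} (hp : 0 < p)
    (hη : 1 ≤ η) (hrho : ∀ᵐ ω ∂P, rho < ∫ x, To ω x ^ 2 ∂sigma)
    (hα : ∀ᵐ ω ∂P, IsScaledKKT η p rho Γ (To ω) (α ω)) (L : ℕ) :
    ENNReal.ofReal rho ≤ eLpNorm (fun z : Ω × S2 => truncMisfit Γ (To z.1) (α z.1) L z.2) 2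
      (P.prod sigma) ^ 2 := by
  rw [eLpNorm_two_prod_sq (aestronglyMeasurable_truncMisfit hΓ hα_meas hTo.1 L)]
  calc ENNReal.ofReal rho = ∫⁻ _, ENNReal.ofReal rho ∂P := by simp
    _ ≤ ∫⁻ ω, eLpNorm (truncMisfit Γ (To ω) (α ω) L) 2 sigma ^ 2 ∂P := lintegral_mono_ae <| by
        filter_upwards [hα, hrho, ae_memLp_two_slice hTo] with ω hω hrhoω hToω
        exact hω.ofReal_le_eLpNorm_truncMisfit_sq hΓ hp hη hToω hrhoω L

end RandomField

end SphereInpainting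

open SphereInpainting in
theorem theorem5p2_general
    {Ω : Type*} [MeasurableSpace Ω] (P : Measure Ω) [IsProbabilityMeasure P]
    (p η rho : ℝ) (hp : 0 < p) (hη : 1 ≤ η) (Γ : Set S2) (hΓ : MeasurableSet Γ)
    (To : Ω → S2 → ℝ) (hTo : MemLp (fun z : Ω × S2 => To z.1 z.2) 2 (P.prod sigma))
    (hrho : ∀ᵐ ω ∂P, rho < ∫ x, To ω x ^ 2 ∂sigma)
    (α : Ω → Coeff) (hα_meas : ∀ (l : ℕ) (m : Orders l), Measurable fun ω => α ω l m)
    (hα : ∀ᵐ ω ∂P, IsScaledKKT η p rho Γ (To ω) (α ω))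
    {E : Type*} [SeminormedAddCommGroup E] (ξ : Ω → E) (hξ : MemLp (fun ω => ‖ξ ω‖) 2 P) (κ : ℝ≥0)
    (hLip : ∀ᵐ ω₁ ∂P, ∀ᵐ ω₂ ∂P,
      eLpNorm (fun x => field (α ω₁) x - field (α ω₂) x) 2 sigma ≤ κ * ‖ξ ω₁ - ξ ω₂‖ₑ)
    (ε : ℝ) (hε : 0 < ε) :
    ∀ᶠ L in Filter.atTop,
      MemLp (fun z : Ω × S2 => inpaint Γ (truncField L (α z.1)) z.2 - (To z.1 z.2 : ℂ)) 2
        (P.prod sigma) ∧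
      0 ≤ (eLpNorm (fun z : Ω × S2 => inpaint Γ (truncField L (α z.1)) z.2 - (To z.1 z.2 : ℂ)) 2
        (P.prod sigma)).toReal ^ 2 - rho ∧
      (eLpNorm (fun z : Ω × S2 => inpaint Γ (truncField L (α z.1)) z.2 - (To z.1 z.2 : ℂ)) 2
        (P.prod sigma)).toReal ^ 2 - rho < ε := by
  have hsum : ∀ᵐ ω ∂P, Summable fun l => ‖α ω l‖ := hα.mono fun _ h => h.1.summable_norm hp hη
  obtain ⟨g, hg, hαg⟩ := exists_memLp_eLpNorm_field_le hsum hξ hLip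
  have hlim := tendsto_eLpNorm_prod_truncMisfit_sq hΓ hα_meas hsum hTo hg hαg
    (c := fun _ => ENNReal.ofReal rho) <| by
      filter_upwards [hα, hrho, ae_memLp_two_slice hTo] with ω hω hrhoω hToω
      exact hω.tendsto_eLpNorm_truncMisfit_sq hΓ hp hη hToω hrhoω
  obtain ⟨ω, hω, hrhoω, hToω⟩ := (hα.and (hrho.and (ae_memLp_two_slice hTo))).exists
  have hlt : ∫⁻ _, ENNReal.ofReal rho ∂P < ENNReal.ofReal (rho + ε) := by
    simpa [ENNReal.ofReal_lt_ofReal_iff_of_nonneg (hω.rho_nonneg hΓ hp hη hToω hrhoω)] using hε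
  filter_upwards [hlim.eventually_lt_const hlt] with L hL
  have hlow := ofReal_le_eLpNorm_prod_truncMisfit_sq hΓ hα_meas hTo hp hη hrho hα L
  have hfin := hL.trans ENNReal.ofReal_lt_top
  refine ⟨⟨aestronglyMeasurable_truncMisfit hΓ hα_meas hTo.1 L,
    (ENNReal.pow_lt_top_iff.1 hfin).resolve_right two_ne_zero⟩, sub_nonneg.2 ?_,
    sub_lt_iff_lt_add'.2 ?_⟩
  · exact ENNReal.toReal_pow _ 2 ▸ (ENNReal.ofReal_le_iff_le_toReal hfin.ne).1 hlow
  · exact ENNReal.toReal_pow _ 2 ▸ (ENNReal.lt_ofReal_iff_toReal_lt hfin.ne).1 hL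

theorem theorem5p2
    {Ω : Type*} [MeasurableSpace Ω] (P : Measure Ω) [IsProbabilityMeasure P]
    -- parameters of the model
    (p η rho : ℝ) (hp0 : 0 < p) (hp1 : p < 1) (hη : 1 < η)
    -- the observed region
    (Γ : Set SphereInpainting.S2) (hΓm : MeasurableSet Γ) (hΓ : (interior Γ).Nonempty)
    (hΓc : Γᶜ.Nonempty)
    -- the observed field
    (To : Ω → SphereInpainting.S2 → ℝ)
    (hTo : MemLp (fun z : Ω × SphereInpainting.S2 => To z.1 z.2) 2
      (P.prod SphereInpainting.sigma))
    (hrho_lower : ∀ᵐ ω ∂P, ∫ x in Γᶜ, To ω x ^ 2 ∂SphereInpainting.sigma < rho)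
    (hrho_upper : ∀ᵐ ω ∂P, rho < ∫ x, To ω x ^ 2 ∂SphereInpainting.sigma)
    -- the random scaled KKT points
    (α : Ω → SphereInpainting.Coeff)
    (hα_meas : ∀ (l : ℕ) (m : SphereInpainting.Orders l), Measurable fun ω => α ω l m)
    (hα : ∀ᵐ ω ∂P, SphereInpainting.IsScaledKKT η p rho Γ (To ω) (α ω))
    -- the randomness `ξ` has finite second moment and the inpainted field is Lipschitz in it
    {E : Type*} [NormedAddCommGroup E] [NormedSpace ℝ E] (ξ : Ω → E)
    (hξ : MemLp (fun ω => ‖ξ ω‖) 2 P) (κ : ℝ≥0)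
    (hLip : ∀ᵐ ω₁ ∂P, ∀ᵐ ω₂ ∂P,
      eLpNorm (fun x => SphereInpainting.field (α ω₁) x - SphereInpainting.field (α ω₂) x) 2
        SphereInpainting.sigma ≤ κ * ‖ξ ω₁ - ξ ω₂‖ₑ) :
    ∀ ε : ℝ, 0 < ε → ∃ L : ℕ,
      MemLp (fun z : Ω × SphereInpainting.S2 =>
        SphereInpainting.inpaint Γ (SphereInpainting.truncField L (α z.1)) z.2 - (To z.1 z.2 : ℂ))
        2 (P.prod SphereInpainting.sigma) ∧
      0 ≤ (eLpNorm (fun z : Ω × SphereInpainting.S2 =>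
        SphereInpainting.inpaint Γ (SphereInpainting.truncField L (α z.1)) z.2 - (To z.1 z.2 : ℂ))
        2 (P.prod SphereInpainting.sigma)).toReal ^ 2 - rho ∧
      (eLpNorm (fun z : Ω × SphereInpainting.S2 =>
        SphereInpainting.inpaint Γ (SphereInpainting.truncField L (α z.1)) z.2 - (To z.1 z.2 : ℂ))
        2 (P.prod SphereInpainting.sigma)).toReal ^ 2 - rho < ε :=
  fun ε hε => (theorem5p2_general P p η rho hp0 hη.le Γ hΓm To hTo hrho_upper α hα_meas hα ξ hξ κ
    hLip ε hε).exists
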